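/- **Proposition 1.4 (Penrose).** An *oriented trivalent graph* is a finite graph $G$, possibly with loops, multiple edges and several connected components, in which every vertex has exactly three half-edges and is endowed with a cyclic ordering of them. Let $sl(2)$ be the Lie algebra of traceless complex $2\times 2$ matrices with the metric $\langle x,y\rangle=\operatorname{tr}(xy)$. For a basis $\{L_a\}$ of $sl(2)$ put $t_{ab}=\langle L_a,L_b\rangle$, let $(t^{ab})$ be the inverse matrix of $(t_{ab})$, and put $f_{abc}=\langle L_a,[L_b,L_c]\rangle$. Let $$W_{sl(2)}(G)=\sum_{l}\ \prod_{\text{vertices}} f_{l(h_1)l(h_2)l(h_3)}\ \prod_{\text{edges}} t^{\,l(h)l(h')},$$ where $l$ runs over all labellings of the half-edges of $G$ by basis indices, $h_1,h_2,h_3$ are the half-edges at a vertex in their cyclic order, and $h,h'$ are the two halves of an edge. Let $G$ be an oriented trivalent graph with $v$ vertices whose underlying graph is embedded in the plane (equivalently, in the sphere); the cyclic orderings of $G$ need not be those induced by the embedding. Let $G^c$ be the map defined by the complement of the embedded graph; its states are the connected components of the complement. Then, for every basis of $sl(2)$, $$|W_{sl(2)}(G)| = 2^{\frac v2-2}\cdot\#\{\text{colorings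 of the states of } G^c \text{ with four colors such that the two states on the two sides of every edge have different colors}\}.$$ (If some state borders itself along an edge, there is no such coloring, and both sides are $0$.) -/

import Mathlib

/-- A finite-dimensional metrized Lie algebra: an ad-invariant symmetric non-degenerate
bilinear form on the Lie algebra `L`. -/
structure LieMetric (K L : Type*) [Field K] [LieRing L] [LieAlgebra K L] where
  form : LinearMap.BilinForm K L
  symm : form.IsSymm
  nondegenerate : form.Nondegenerate
  invariant : ∀ x y z : L, form ⁅x, y⁆ z = form x ⁅y, z⁆

namespace LieMetric

variable {K L : Type*} [Field K] [LieRing L] [LieAlgebra K L] (B : LieMetric K L)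
  {ι : Type*} [Fintype ι] [DecidableEq ι] (b : Module.Basis ι K L)

/-- The metric tensor `t_{ab} = ⟨L_a, L_b⟩`. -/
noncomputable def metricTensor {ι : Type*} (b : Module.Basis ι K L) : Matrix ι ι K :=
  Matrix.of fun i j => B.form (b i) (b j)

/-- The inverse `t^{ab}` of the metric tensor. -/
noncomputable def inverseMetric : Matrix ι ι K := (B.metricTensor b)⁻¹

/-- The structure constants `f_{abc} = ⟨L_a, [L_b, L_c]⟩`. -/
noncomputable def structureConstant {ι : Type*} (b : Module.Basis ι K L) (i j k : ι) : K :=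
  B.form (b i) ⁅b j, b k⁆

theorem inverseMetric_comm (i j : ι) : B.inverseMetric b i j = B.inverseMetric b j i := by
  have h : (B.metricTensor b).transpose = B.metricTensor b := by
    ext x y
    exact B.symm.eq _ _
  have h2 : (B.inverseMetric b).transpose = B.inverseMetric b := by
    rw [inverseMetric, Matrix.transpose_nonsing_inv, h]
  exact congrFun (congrFun h2 j) i

end LieMetric

/-- The Lie algebra `sl(2)`: the traceless complex `2 × 2` matrices. -/
abbrev SL2 : Type := LieAlgebra.SpecialLinear.sl (Fin 2) ℂ

/-- The form `⟨x, y⟩ = tr (x y)` (trace in the defining representation) on `sl(2)`. -/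
noncomputable def sl2TraceForm : LinearMap.BilinForm ℂ SL2 :=
  LinearMap.mk₂ ℂ (fun x y => Matrix.trace (x.val * y.val))
    (fun x y z => by simp [add_mul]) (fun c x y => by simp)
    (fun x y z => by simp [mul_add]) (fun c x y => by simp)

/-- `sl(2)` with the trace in the defining representation as its metric. -/
noncomputable def sl2Metric : LieMetric ℂ SL2 where
  form := sl2TraceForm
  symm := ⟨fun x y => Matrix.trace_mul_comm x.val y.val⟩
  nondegenerate := by
    have key : ∀ x : SL2, (∀ y : SL2, Matrix.trace (x.val * y.val) = 0) → x = 0 := by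
      intro x hx
      have h0 : Matrix.trace x.val = 0 := x.property
      have h1 := hx (LieAlgebra.SpecialLinear.single 0 1 (by decide) 1)
      have h2 := hx (LieAlgebra.SpecialLinear.single 1 0 (by decide) 1)
      have h3 := hx (LieAlgebra.SpecialLinear.singleSubSingle 0 1 1)
      simp [Matrix.trace, Matrix.mul_apply, Fin.sum_univ_two, Matrix.single_apply] at h0 h1 h2 h3
      apply Subtype.ext
      ext i j
      fin_cases i <;> fin_cases j <;> simp <;> grind
    refine ⟨fun x hx => key x hx, fun y hy => key y fun x => ?_⟩
    rw [Matrix.trace_mul_comm]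
    exact hy x
  invariant := by
    intro x y z
    change Matrix.trace ((⁅x, y⁆ : SL2).val * z.val) = Matrix.trace (x.val * (⁅y, z⁆ : SL2).val)
    rw [LieAlgebra.SpecialLinear.sl_bracket, LieAlgebra.SpecialLinear.sl_bracket, sub_mul, mul_sub,
      Matrix.trace_sub, Matrix.trace_sub, mul_assoc, mul_assoc y.val,
      Matrix.trace_mul_comm y.val, mul_assoc x.val z.val]

/-- An oriented trivalent graph with vertex set `V`; loops, multiple edges and several connected
components are allowed.  The three half-edges at the vertex `v` are `(v, 0)`, `(v, 1)`, `(v, 2)`,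
and this is their cyclic order at `v`.  The two half-edges of every edge are exchanged by
`opp`. -/
structure OrientedTrivalentGraph (V : Type*) where
  opp : Equiv.Perm (V × Fin 3)
  opp_opp : ∀ h, opp (opp h) = h
  opp_ne : ∀ h, opp h ≠ h

namespace OrientedTrivalentGraph

variable {V : Type*} [Fintype V] [DecidableEq V] (G : OrientedTrivalentGraph V)

/-- The edges, each of them given as the unordered pair of its two half-edges. -/
def edges : Finset (Sym2 (V × Fin 3)) :=
  Finset.univ.image fun h => s(h, G.opp h)

/-- The functional `W_L` at `G`, computed in the basis `b` of the metrized Lie algebra `L`: the sum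
over all labellings of the half-edges by basis indices of the product over the vertices of the
structure constants, read in the cyclic order of the vertex, times the product over the edges of
the entries of the inverse metric tensor. -/
noncomputable def weight {K L : Type*} [Field K] [LieRing L] [LieAlgebra K L] (B : LieMetric K L)
    {ι : Type*} [Fintype ι] [DecidableEq ι] (b : Module.Basis ι K L) : K :=
  ∑ l : V × Fin 3 → ι,
    (∏ v : V, B.structureConstant b (l (v, 0)) (l (v, 1)) (l (v, 2))) *
    ∏ e ∈ G.edges, Sym2.lift
      ⟨fun h h' => B.inverseMetric b (l h) (l h'), fun _ _ => B.inverseMetric_comm b _ _⟩ e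

/-- An embedding of the (possibly disconnected) graph underlying `G` in an oriented sphere, with
`F` as its set of states (connected components of the complement), up to homeomorphism.

`rot` is the counterclockwise order in which the half-edges at each vertex appear on the sphere;
it need not agree with the cyclic orders that are part of `G`.  The band thickening of `G` given
by `rot` has one boundary circle for each orbit of `h ↦ rot⁻¹ (opp h)`, the circle that runs on
the left of the half-edges `h` of the orbit when each is traversed away from its vertex.  The
state on the left of `h` is `state h`, so `state h` and `state (opp h)` lie on the two sides of
the edge of `h`.  Each state is, up to homeomorphism, the interior of a sphere with `k` holes, where
`k` is the number of boundary circles of the thickening that `state` maps to it (`k` may exceed `1`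
if `G` is disconnected).

Gluing these states into the thickening gives a closed oriented surface.  The last two fields say
that it is a sphere: it is connected (any two states are linked by a chain in which consecutive
states share an edge), and its Euler characteristic
`#V - #edges + ∑ over states of (2 - k)` is `2`. -/
structure PlanarEmbedding (F : Type*) [Fintype F] where
  rot : Equiv.Perm (V × Fin 3)
  rot_fst : ∀ h, (rot h).1 = h.1
  rot_ne : ∀ h, rot h ≠ h
  state : V × Fin 3 → F
  state_next : ∀ h, state (rot⁻¹ (G.opp h)) = state h
  connected : (SimpleGraph.fromRel fun f g : F => ∃ h, state h = f ∧ state (G.opp h) = g).Connected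
  euler : (Fintype.card V : ℤ) - G.edges.card + (2 * Fintype.card F -
    Nat.card (Quotient (Equiv.Perm.SameCycle.setoid (rot⁻¹ * G.opp)))) = 2

variable {G} {F : Type*} [Fintype F]

/-- The colorings with four colors of the states of the complement such that the two states on the
two sides of every edge have different colors.  (There are none if a state borders itself.) -/
def PlanarEmbedding.FourColoring (E : G.PlanarEmbedding F) : Type _ :=
  {c : F → Fin 4 // ∀ h, c (E.state h) ≠ c (E.state (G.opp h))}

end OrientedTrivalentGraph

/-! The scaled Pauli matrices are orthonormal for the trace form, with structure constants √2·i·ε.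
In this frame every edge carries a single index, so the weight is (√2·i)^v times the sum, over
labellings of the edges by three indices, of the product of ε over the vertices. Only proper edge
3-colorings (Tait colorings) contribute, each by ±1.

Name the three edge colors by the nonzero elements of the Klein group. A Tait coloring is then a
cycle mod 2, hence on the sphere the coboundary of a coloring of the states, proper because edge
colors are nonzero, and unique up to one of four translations (`card_fourColoring`). So there are
four times as many state colorings as Tait colorings.

No cancellation occurs (`prod_leviCivita_taitColoring`). Up to a sign depending only on the
embedding, ε at a vertex is a product over its three half-edges of a sign function, antisymmetric on
pairs of distinct colors, of the states on their two sides. The two halves of an edge see these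
states in opposite order and together give -1, whatever the coloring. -/

/-- The totally antisymmetric symbol in three dimensions. -/
def leviCivita (a b c : Fin 3) : ℤ :=
  ((b : ℤ) - a) * ((c : ℤ) - a) * ((c : ℤ) - b) / 2

/-- The Pauli matrices, as elements of `sl(2)`. -/
noncomputable def pauli (a : Fin 3) : SL2 :=
  ⟨![!![0, 1; 1, 0], !![0, -Complex.I; Complex.I, 0], !![1, 0; 0, -1]] a, by
    change Matrix.trace (n := Fin 2) _ = 0
    fin_cases a <;> simp [Matrix.trace_fin_two]⟩

/-- The Pauli matrices, scaled to be orthonormal for the trace form. -/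
noncomputable def normalizedPauli (a : Fin 3) : SL2 := ((√2 : ℝ) : ℂ)⁻¹ • pauli a

theorem sqrt_two_complex_sq : (((√2 : ℝ) : ℂ)) ^ 2 = 2 := by
  rw [← Complex.ofReal_pow, Real.sq_sqrt (by norm_num)]; norm_num

theorem sqrt_two_complex_ne_zero : (((√2 : ℝ) : ℂ)) ≠ 0 := by
  intro h
  have := sqrt_two_complex_sq
  rw [h] at this
  norm_num at this

theorem sl2TraceForm_pauli (a b : Fin 3) :
    sl2TraceForm (pauli a) (pauli b) = if a = b then 2 else 0 := by
  change Matrix.trace ((pauli a).val * (pauli b).val) = _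
  fin_cases a <;> fin_cases b <;>
    simp [pauli, Matrix.trace_fin_two] <;> norm_num

theorem sl2TraceForm_pauli_bracket (a b c : Fin 3) :
    sl2TraceForm (pauli a) ⁅pauli b, pauli c⁆ = 4 * Complex.I * leviCivita a b c := by
  change Matrix.trace ((pauli a).val * (⁅pauli b, pauli c⁆ : SL2).val) = _
  rw [LieAlgebra.SpecialLinear.sl_bracket]
  fin_cases a <;> fin_cases b <;> fin_cases c <;>
    simp [pauli, Matrix.trace_fin_two, leviCivita] <;> ring

theorem sl2Metric_normalizedPauli (a b : Fin 3) :
    sl2Metric.form (normalizedPauli a) (normalizedPauli b) = if a = b then 1 else 0 := by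
  change sl2TraceForm _ _ = _
  have h := sqrt_two_complex_sq
  have h0 := sqrt_two_complex_ne_zero
  simp only [normalizedPauli, map_smul, LinearMap.smul_apply, sl2TraceForm_pauli, smul_eq_mul]
  split_ifs
  · field_simp
    exact h.symm
  · simp

theorem sl2Metric_normalizedPauli_bracket (a b c : Fin 3) :
    sl2Metric.form (normalizedPauli a) ⁅normalizedPauli b, normalizedPauli c⁆ =
      ((√2 : ℝ) : ℂ) * Complex.I * leviCivita a b c := by
  change sl2TraceForm _ _ = _
  have h := sqrt_two_complex_sq
  have h0 := sqrt_two_complex_ne_zero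
  simp only [normalizedPauli, map_smul, LinearMap.smul_apply, smul_eq_mul, smul_lie, lie_smul,
    sl2TraceForm_pauli_bracket]
  field_simp
  -- With s = √2 what remains is 4 = s⁴, and s⁴ - 4 = (s² + 2)(s² - 2).
  linear_combination (-(((√2 : ℝ) : ℂ) ^ 2 + 2) * leviCivita a b c) * h

/-! ### Products over edges and half-edges -/

namespace OrientedTrivalentGraph

variable {V : Type*} [Fintype V] [DecidableEq V] (G : OrientedTrivalentGraph V)

/-- The edge to which a half-edge belongs. -/
def edgeOf (h : V × Fin 3) : G.edges :=
  ⟨s(h, G.opp h), Finset.mem_image_of_mem _ (Finset.mem_univ h)⟩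

theorem edgeOf_opp (h : V × Fin 3) : G.edgeOf (G.opp h) = G.edgeOf h := by
  apply Subtype.ext
  simp [edgeOf, G.opp_opp, Sym2.eq_swap]

theorem edgeOf_eq_iff {h h' : V × Fin 3} :
    G.edgeOf h' = G.edgeOf h ↔ h' = h ∨ h' = G.opp h := by
  constructor
  · intro e
    have e' := congrArg Subtype.val e
    simp only [edgeOf, Sym2.eq_iff] at e'
    tauto
  · rintro (rfl | rfl)
    · rfl
    · exact G.edgeOf_opp h

theorem edgeOf_surjective : Function.Surjective G.edgeOf := by
  rintro ⟨e, he⟩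
  obtain ⟨h, -, rfl⟩ := Finset.mem_image.1 he
  exact ⟨h, rfl⟩

theorem filter_edgeOf_eq (h : V × Fin 3) :
    (Finset.univ.filter fun h' => G.edgeOf h' = G.edgeOf h) = {h, G.opp h} := by
  ext h'
  simp [G.edgeOf_eq_iff]

theorem prod_halfEdges {M : Type*} [CommMonoid M] (φ : V × Fin 3 → M) (ψ : G.edges → M)
    (hψ : ∀ h, φ h * φ (G.opp h) = ψ (G.edgeOf h)) : ∏ h, φ h = ∏ e, ψ e := by
  rw [← Finset.prod_fiberwise_of_maps_to (s := Finset.univ) (t := Finset.univ) (g := G.edgeOf)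
    (fun _ _ => Finset.mem_univ _)]
  refine Finset.prod_congr rfl fun e _ => ?_
  obtain ⟨h, rfl⟩ := G.edgeOf_surjective e
  rw [G.filter_edgeOf_eq, Finset.prod_pair (G.opp_ne h).symm, hψ]

theorem prod_vertices_halfEdges {V : Type*} [Fintype V] {M : Type*} [CommMonoid M] (φ : V × Fin 3 → M) :
    ∏ v, (φ (v, 0) * φ (v, 1) * φ (v, 2)) = ∏ h, φ h := by
  rw [Fintype.prod_prod_type]
  simp [Fin.prod_univ_three]

end OrientedTrivalentGraph

/-! ### The weight in an orthonormal frame -/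

namespace LieMetric

variable {K L : Type*} [Field K] [LieRing L] [LieAlgebra K L] (B : LieMetric K L)
  {ι κ : Type*} [Fintype ι] [DecidableEq ι] [Fintype κ] [DecidableEq κ] (b : Module.Basis ι K L)

/-- With Q the coordinates of the frame and T the metric tensor, orthonormality says QᵀTQ = 1. Equal
cardinalities let the factors be cycled to QQᵀT = 1, so T⁻¹ = QQᵀ. -/
theorem inverseMetric_eq_sum_of_orthonormal (hcard : Fintype.card ι = Fintype.card κ) (e : κ → L)
    (he : ∀ a c, B.form (e a) (e c) = if a = c then 1 else 0) (i j : ι) :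
    B.inverseMetric b i j = ∑ a, b.repr (e a) i * b.repr (e a) j := by
  let Q : Matrix ι κ K := Matrix.of fun i a => b.repr (e a) i
  have h1 : (Q.transpose * B.metricTensor b) * Q = 1 := by
    ext a c
    rw [Matrix.one_apply, ← he, Matrix.mul_apply]
    conv_rhs => rw [← b.sum_repr (e a), ← b.sum_repr (e c)]
    simp only [Matrix.mul_apply, map_sum, LinearMap.sum_apply, map_smul, LinearMap.smul_apply,
      smul_eq_mul, Matrix.transpose_apply, Q, Matrix.of_apply, metricTensor, Finset.sum_mul,
      Finset.mul_sum]
    refine Finset.sum_congr rfl fun x _ => Finset.sum_congr rfl fun y _ => by ring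
  have h2 : Q * (Q.transpose * B.metricTensor b) = 1 :=
    (Matrix.mul_eq_one_comm_of_card_eq _ _ _ hcard.symm).1 h1
  rw [← Matrix.mul_assoc] at h2
  rw [inverseMetric, Matrix.inv_eq_left_inv h2]
  simp [Matrix.mul_apply, Q]

theorem sum_structureConstant {ι : Type*} [Fintype ι] (b : Module.Basis ι K L) (x y z : L) :
    ∑ l : Fin 3 → ι, B.structureConstant b (l 0) (l 1) (l 2) *
      (b.repr x (l 0) * b.repr y (l 1) * b.repr z (l 2)) = B.form x ⁅y, z⁆ := by
  classical
  let e : (Fin 3 → ι) ≃ ι × ι × ι :=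
    { toFun := fun l => (l 0, l 1, l 2)
      invFun := fun p => ![p.1, p.2.1, p.2.2]
      left_inv := fun l => by ext i; fin_cases i <;> rfl
      right_inv := fun p => rfl }
  refine (Fintype.sum_equiv e _ (fun p => B.structureConstant b p.1 p.2.1 p.2.2 *
      (b.repr x p.1 * b.repr y p.2.1 * b.repr z p.2.2)) (fun l => rfl)).trans ?_
  conv_rhs => rw [← b.sum_repr x, ← b.sum_repr y, ← b.sum_repr z]
  simp only [Fintype.sum_prod_type, map_sum, LinearMap.sum_apply, sum_lie, lie_sum, smul_lie,
    lie_smul, map_smul, LinearMap.smul_apply, smul_eq_mul, structureConstant]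
  simp only [Finset.mul_sum]
  refine (Finset.sum_congr rfl fun _ _ => Finset.sum_comm).trans ?_
  refine Finset.sum_comm.trans ?_
  refine (Finset.sum_congr rfl fun _ _ => Finset.sum_comm).trans ?_
  refine Finset.sum_congr rfl fun i _ => Finset.sum_congr rfl fun j _ =>
    Finset.sum_congr rfl fun k _ => by ring

end LieMetric

namespace OrientedTrivalentGraph

variable {V : Type*} [Fintype V] [DecidableEq V] (G : OrientedTrivalentGraph V)

/-- Each inverse metric entry splits into a sum over one frame index per edge. Exchanging the sums
leaves at every vertex a multilinear expansion of the bracket form on frame vectors. -/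
theorem weight_eq_of_orthonormal {K L : Type*} [Field K] [LieRing L] [LieAlgebra K L]
    (B : LieMetric K L) {ι κ : Type*} [Fintype ι] [DecidableEq ι] [Fintype κ] [DecidableEq κ]
    (b : Module.Basis ι K L) (hcard : Fintype.card ι = Fintype.card κ) (e : κ → L)
    (he : ∀ a c, B.form (e a) (e c) = if a = c then 1 else 0) :
    G.weight B b = ∑ x : G.edges → κ, ∏ v : V,
      B.form (e (x (G.edgeOf (v, 0)))) ⁅e (x (G.edgeOf (v, 1))), e (x (G.edgeOf (v, 2)))⁆ := by
  have hprop : ∀ l : V × Fin 3 → ι, (∏ e ∈ G.edges, Sym2.lift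
      ⟨fun h h' => B.inverseMetric b (l h) (l h'), fun _ _ => B.inverseMetric_comm b _ _⟩ e) =
      ∑ x : G.edges → κ, ∏ h, b.repr (e (x (G.edgeOf h))) (l h) := by
    intro l
    let R : G.edges → κ → K := fun p a => Sym2.lift
      ⟨fun h h' => b.repr (e a) (l h) * b.repr (e a) (l h'), fun _ _ => mul_comm _ _⟩ p.1
    have hR : ∀ p : G.edges, Sym2.lift ⟨fun h h' => B.inverseMetric b (l h) (l h'),
        fun _ _ => B.inverseMetric_comm b _ _⟩ p.1 = ∑ a, R p a := by
      intro p
      obtain ⟨h, rfl⟩ := G.edgeOf_surjective p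
      exact B.inverseMetric_eq_sum_of_orthonormal b hcard e he _ _
    rw [← Finset.prod_coe_sort]
    simp_rw [hR]
    rw [Finset.prod_univ_sum, Fintype.piFinset_univ]
    refine Finset.sum_congr rfl fun x _ => ?_
    refine (G.prod_halfEdges _ _ fun h => ?_).symm
    rw [G.edgeOf_opp]
    rfl
  unfold weight
  simp_rw [hprop, Finset.mul_sum]
  rw [Finset.sum_comm]
  refine Finset.sum_congr rfl fun x _ => ?_
  simp_rw [← B.sum_structureConstant b]
  rw [Finset.prod_univ_sum, Fintype.piFinset_univ]
  refine Fintype.sum_equiv (Equiv.curry V (Fin 3) ι) _ _ fun l => ?_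
  rw [← prod_vertices_halfEdges, ← Finset.prod_mul_distrib]
  rfl

theorem norm_weight_sl2 {ι : Type*} [Fintype ι] [DecidableEq ι] (b : Module.Basis ι ℂ SL2) :
    ‖G.weight sl2Metric b‖ = √2 ^ Fintype.card V *
      |((∑ x : G.edges → Fin 3, ∏ v : V, leviCivita (x (G.edgeOf (v, 0)))
        (x (G.edgeOf (v, 1))) (x (G.edgeOf (v, 2))) : ℤ) : ℝ)| := by
  -- Any basis of sl(2) has three elements, by explicit coordinates.
  have hcard : Fintype.card ι = Fintype.card (Fin 3) := by
    let e : SL2 ≃ₗ[ℂ] (Fin 3 → ℂ) :=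
      { toFun := fun x => ![x.val 0 0, x.val 0 1, x.val 1 0]
        map_add' := fun x y => by ext i; fin_cases i <;> rfl
        map_smul' := fun c x => by ext i; fin_cases i <;> rfl
        invFun := fun w => ⟨!![w 0, w 1; w 2, -w 0], by
          change Matrix.trace (n := Fin 2) _ = 0
          simp [Matrix.trace_fin_two]⟩
        left_inv := fun x => by
          have hx : Matrix.trace x.val = 0 := x.property
          rw [Matrix.trace_fin_two] at hx
          apply Subtype.ext
          ext i j
          fin_cases i <;> fin_cases j <;> simp
          exact neg_eq_of_add_eq_zero_right hx
        right_inv := fun w => by ext i; fin_cases i <;> rfl }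
    rw [← Module.finrank_eq_card_basis b, e.finrank_eq, Module.finrank_fintype_fun_eq_card]
  rw [G.weight_eq_of_orthonormal sl2Metric b hcard normalizedPauli sl2Metric_normalizedPauli]
  simp_rw [sl2Metric_normalizedPauli_bracket, Finset.prod_mul_distrib, ← Finset.mul_sum]
  rw [norm_mul, ← Complex.norm_intCast]
  simp [abs_of_nonneg (Real.sqrt_nonneg 2)]

end OrientedTrivalentGraph

/-! ### Signs on the Klein group -/

/-- Two-dimensional space over the field with two elements, used as the set of colors. -/
abbrev Klein : Type := ZMod 2 × ZMod 2

/-- The nonzero elements of the Klein four-group. -/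
def kleinVec (a : Fin 3) : Klein := ![(1, 0), (0, 1), (1, 1)] a

/-- The signs of a tournament on the Klein four-group. -/
def tournament (p q : Klein) : ℤ :=
  let n : Klein → ℤ := fun p => p.1.val + 2 * p.2.val
  (if n p < n q then 1 else -1) * (if p.1 = 1 ∧ q.1 = 1 then -1 else 1)

theorem tournament_mul_swap : ∀ p q : Klein, p ≠ q → tournament p q * tournament q p = -1 := by
  decide

theorem tournament_ne_zero (p q : Klein) : tournament p q ≠ 0 := by
  revert p q
  decide

theorem kleinVec_injective : Function.Injective kleinVec := by decide

theorem kleinVec_ne_zero : ∀ a, kleinVec a ≠ 0 := by decide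

theorem exists_kleinVec_eq : ∀ p : Klein, p ≠ 0 → ∃ a, kleinVec a = p := by decide

/-- This is the sign around a vertex whose rotation agrees with its cyclic order; the primed version
is for the reversed rotation. Distinctness of p, q, r is automatic, since `kleinVec` never vanishes.
-/
theorem leviCivita_kleinVec : ∀ p q r : Klein, ∀ a b c : Fin 3, kleinVec a = p + r →
    kleinVec b = q + p → kleinVec c = r + q →
    leviCivita a b c = -(tournament p r * tournament q p * tournament r q) := by
  decide

theorem leviCivita_kleinVec' : ∀ p q r : Klein, ∀ a b c : Fin 3, kleinVec a = p + q →
    kleinVec b = q + r → kleinVec c = r + p →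
    leviCivita a b c = tournament p q * tournament q r * tournament r p := by
  decide

theorem kleinVec_sum_eq_zero : ∀ a b c : Fin 3, leviCivita a b c ≠ 0 →
    kleinVec a + kleinVec b + kleinVec c = 0 := by decide

/-! ### Cycles and boundaries mod 2 on the sphere -/

namespace OrientedTrivalentGraph

variable {V : Type*} [Fintype V] [DecidableEq V] {G : OrientedTrivalentGraph V}
  {F : Type*} [Fintype F]

namespace PlanarEmbedding

variable (E : G.PlanarEmbedding F)

theorem rot_inv_fst (h : V × Fin 3) : (E.rot⁻¹ h).1 = h.1 := by
  rw [← E.rot_fst (E.rot⁻¹ h)]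
  simp

theorem state_rot_inv (h : V × Fin 3) : E.state (E.rot⁻¹ h) = E.state (G.opp h) := by
  rw [← E.state_next (G.opp h), G.opp_opp]

theorem state_opp_eq_of_rot_eq {h h' : V × Fin 3} (hh : E.rot h' = h) :
    E.state (G.opp h) = E.state h' := by
  rw [← E.state_rot_inv, ← hh]
  simp

/-- The rotation at a vertex is either the given cyclic order or its reverse. -/
theorem rot_eq_or (v : V) :
    (E.rot (v, 0) = (v, 1) ∧ E.rot (v, 1) = (v, 2) ∧ E.rot (v, 2) = (v, 0)) ∨
      (E.rot (v, 1) = (v, 0) ∧ E.rot (v, 2) = (v, 1) ∧ E.rot (v, 0) = (v, 2)) := by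
  have hex : ∀ i, ∃ j, E.rot (v, i) = (v, j) := fun i =>
    ⟨(E.rot (v, i)).2, Prod.ext (E.rot_fst _) rfl⟩
  choose f hf using hex
  have hne : ∀ i, f i ≠ i := fun i hi => E.rot_ne (v, i) (by rw [hf, hi])
  have hinj : Function.Injective f := fun i j hij => by
    have := E.rot.injective ((hf i).trans ((congrArg (Prod.mk v) hij).trans (hf j).symm))
    exact congrArg Prod.snd this
  have key : ∀ f : Fin 3 → Fin 3, (∀ i, f i ≠ i) → Function.Injective f →
      (f 0 = 1 ∧ f 1 = 2 ∧ f 2 = 0) ∨ (f 1 = 0 ∧ f 2 = 1 ∧ f 0 = 2) := by decide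
  simp only [hf, Prod.mk.injEq, true_and]
  exact key f hne hinj

/-- Each state corner at a vertex lies between two consecutive half-edges, so its value occurs
twice. -/
theorem sum_coboundary_vertex {A : Type*} [AddCommGroup A] (hA : ∀ a : A, a + a = 0) (c : F → A)
    (v : V) : (c (E.state (v, 0)) + c (E.state (G.opp (v, 0)))) +
      (c (E.state (v, 1)) + c (E.state (G.opp (v, 1)))) +
      (c (E.state (v, 2)) + c (E.state (G.opp (v, 2)))) = 0 := by
  rcases E.rot_eq_or v with ⟨h0, h1, h2⟩ | ⟨h0, h1, h2⟩ <;>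
  · rw [E.state_opp_eq_of_rot_eq h0, E.state_opp_eq_of_rot_eq h1, E.state_opp_eq_of_rot_eq h2]
    have e0 := hA (c (E.state (v, 0)))
    have e1 := hA (c (E.state (v, 1)))
    have e2 := hA (c (E.state (v, 2)))
    calc _ = (c (E.state (v, 0)) + c (E.state (v, 0))) + (c (E.state (v, 1)) + c (E.state (v, 1)))
          + (c (E.state (v, 2)) + c (E.state (v, 2))) := by abel
      _ = 0 := by rw [e0, e1, e2]; simp

/-- A function on the states that agrees on both sides of every edge is constant. -/
theorem eq_of_forall_edge {A : Type*} (g : F → A)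
    (hg : ∀ h, g (E.state h) = g (E.state (G.opp h))) (f f' : F) : g f = g f' := by
  obtain ⟨p⟩ := E.connected.preconnected f f'
  induction p with
  | nil => rfl
  | cons hadj _ ih =>
    rw [← ih]
    obtain ⟨-, ⟨h, rfl, rfl⟩ | ⟨h, rfl, rfl⟩⟩ := (SimpleGraph.fromRel_adj _ _ _).1 hadj
    · exact hg h
    · exact (hg h).symm

theorem eq_of_sameCycle {A : Type*} (y : V × Fin 3 → A)
    (hy : ∀ h, y (E.rot⁻¹ (G.opp h)) = y h) {h h' : V × Fin 3}
    (hh : (E.rot⁻¹ * G.opp).SameCycle h h') : y h = y h' := by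
  obtain ⟨n, rfl⟩ := hh.exists_nat_pow_eq
  induction n with
  | zero => rfl
  | succ n ih =>
    rw [pow_succ', Equiv.Perm.mul_apply, Equiv.Perm.mul_apply, hy]
    exact ih (Equiv.Perm.sameCycle_pow_right.2 (Equiv.Perm.SameCycle.refl _ _))

variable (G) in
/-- The functions on the vertices that are constant on the components of the graph. -/
def locallyConstant : Submodule (ZMod 2) (V → ZMod 2) where
  carrier := {f | ∀ h, f h.1 = f (G.opp h).1}
  add_mem' := fun hf hg h => by simp [hf h, hg h]
  zero_mem' := fun h => rfl
  smul_mem' := fun c f hf h => by simp [hf h]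

variable (G) in
/-- The map that sends a function on the edges to its sums around the vertices. -/
def vertexSum : (G.edges → ZMod 2) →ₗ[ZMod 2] (V → ZMod 2) where
  toFun y v := ∑ i : Fin 3, y (G.edgeOf (v, i))
  map_add' y z := by ext v; simp [Finset.sum_add_distrib]
  map_smul' c y := by ext v; simp [Finset.mul_sum]

/-- The coboundary of a function on the states, as a function on the edges. -/
def coboundary : (F → ZMod 2) →ₗ[ZMod 2] (G.edges → ZMod 2) where
  toFun g e := Sym2.lift ⟨fun h h' => g (E.state h) + g (E.state h'), fun _ _ => add_comm _ _⟩ e.1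
  map_add' g g' := by
    ext e
    obtain ⟨h, rfl⟩ := G.edgeOf_surjective e
    simp only [edgeOf, Sym2.lift_mk, Pi.add_apply]
    abel
  map_smul' c g := by
    ext e
    obtain ⟨h, rfl⟩ := G.edgeOf_surjective e
    simp only [edgeOf, Sym2.lift_mk, Pi.smul_apply, smul_add, RingHom.id_apply]

theorem coboundary_edgeOf (g : F → ZMod 2) (h : V × Fin 3) :
    E.coboundary g (G.edgeOf h) = g (E.state h) + g (E.state (G.opp h)) := rfl

theorem range_coboundary_le : LinearMap.range E.coboundary ≤ LinearMap.ker (vertexSum G) := by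
  rintro _ ⟨g, rfl⟩
  ext v
  simp only [vertexSum, LinearMap.coe_mk, AddHom.coe_mk, Fin.sum_univ_three, coboundary_edgeOf]
  exact E.sum_coboundary_vertex CharTwo.add_self_eq_zero g v

/-- Connectedness leaves only constants in the kernel of the coboundary. -/
theorem card_le_finrank_range_coboundary :
    Fintype.card F ≤ Module.finrank (ZMod 2) (LinearMap.range E.coboundary) + 1 := by
  have h1 := E.coboundary.finrank_range_add_finrank_ker
  rw [Module.finrank_fintype_fun_eq_card] at h1
  obtain ⟨f₀⟩ := E.connected.nonempty
  have h2 : Module.finrank (ZMod 2) (LinearMap.ker E.coboundary) ≤ Module.finrank (ZMod 2) (ZMod 2) := by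
    refine LinearMap.finrank_le_finrank_of_injective
      (f := (LinearMap.proj f₀ : (F → ZMod 2) →ₗ[ZMod 2] ZMod 2).domRestrict _) ?_
    rw [injective_iff_map_eq_zero]
    rintro ⟨g, hg⟩ h0
    apply Subtype.ext
    ext f
    change g f = 0
    rw [E.eq_of_forall_edge g (fun h => ?_) f f₀]
    · exact h0
    · have := congrFun (LinearMap.mem_ker.1 hg) (G.edgeOf h)
      rw [coboundary_edgeOf] at this
      exact CharTwo.add_eq_zero.1 this
  rw [Module.finrank_self] at h2
  omega

variable (G) in
-- The incidence matrix and its transpose have equal rank, and the kernel of the transpose is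
-- `locallyConstant G`. A loop meets its vertex twice and so contributes 0 mod 2.
theorem finrank_ker_vertexSum_add_card :
    Module.finrank (ZMod 2) (LinearMap.ker (vertexSum G)) + Fintype.card V =
      G.edges.card + Module.finrank (ZMod 2) (locallyConstant G) := by
  let M : Matrix V G.edges (ZMod 2) :=
    Matrix.of fun v e => ∑ i : Fin 3, if G.edgeOf (v, i) = e then 1 else 0
  have hM : M.mulVecLin = vertexSum G := by
    refine LinearMap.ext fun y => funext fun v => ?_
    change ∑ e, (∑ i : Fin 3, if G.edgeOf (v, i) = e then 1 else 0) * y e =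
      ∑ i, y (G.edgeOf (v, i))
    simp_rw [Finset.sum_mul]
    rw [Finset.sum_comm]
    simp
  have hMT : LinearMap.ker M.transpose.mulVecLin = locallyConstant G := by
    have hsum : ∀ (f : V → ZMod 2) (h : V × Fin 3),
        M.transpose.mulVecLin f (G.edgeOf h) = f h.1 + f (G.opp h).1 := by
      intro f h
      change ∑ v, (∑ i : Fin 3, if G.edgeOf (v, i) = G.edgeOf h then 1 else 0) * f v = _
      simp_rw [Finset.sum_mul, ite_mul, one_mul, zero_mul]
      rw [← Fintype.sum_prod_type'
        (f := fun v i => if G.edgeOf (v, i) = G.edgeOf h then f v else 0),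
        ← Finset.sum_filter]
      simp only [Prod.mk.eta]
      rw [G.filter_edgeOf_eq, Finset.sum_pair (G.opp_ne h).symm]
    ext f
    rw [LinearMap.mem_ker]
    constructor
    · intro hf h
      rw [← CharTwo.add_eq_zero, ← hsum, hf]
      rfl
    · intro hf
      ext e
      obtain ⟨h, rfl⟩ := G.edgeOf_surjective e
      rw [hsum, ← hf h]
      exact CharTwo.add_self_eq_zero _
  have h1 := M.mulVecLin.finrank_range_add_finrank_ker
  have h2 := M.transpose.mulVecLin.finrank_range_add_finrank_ker
  have h3 : M.transpose.rank = M.rank := M.rank_transpose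
  rw [Module.finrank_fintype_fun_eq_card] at h1 h2
  rw [hMT] at h2
  rw [Matrix.rank, Matrix.rank] at h3
  rw [Fintype.card_coe] at h1
  rw [hM] at h1 h3
  omega

/-- Join states to graph components by one edge per boundary circle. This bipartite graph is
connected, so it has at most one more vertex than edges; `Φ` is its coboundary mod 2. -/
theorem card_add_finrank_le :
    Fintype.card F + Module.finrank (ZMod 2) (locallyConstant G) ≤
      Nat.card (Quotient (Equiv.Perm.SameCycle.setoid (E.rot⁻¹ * G.opp))) + 1 := by
  classical
  set Q := Quotient (Equiv.Perm.SameCycle.setoid (E.rot⁻¹ * G.opp))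
  have : Fintype Q := Fintype.ofFinite Q
  let Φ : ((F → ZMod 2) × locallyConstant G) →ₗ[ZMod 2] (Q → ZMod 2) :=
    { toFun := fun p q => p.1 (E.state q.out) + p.2.1 q.out.1
      map_add' := fun p p' => by
        ext q
        simp only [Prod.fst_add, Prod.snd_add, Pi.add_apply, Submodule.coe_add]
        abel
      map_smul' := fun c p => by
        ext q
        simp [mul_add] }
  have h1 := Φ.finrank_range_add_finrank_ker
  rw [Module.finrank_prod, Module.finrank_fintype_fun_eq_card] at h1
  have h2 : Module.finrank (ZMod 2) (LinearMap.range Φ) ≤ Nat.card Q := by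
    rw [Nat.card_eq_fintype_card, ← Module.finrank_fintype_fun_eq_card (ZMod 2)]
    exact Submodule.finrank_le _
  obtain ⟨f₀⟩ := E.connected.nonempty
  have h3 : Module.finrank (ZMod 2) (LinearMap.ker Φ) ≤ Module.finrank (ZMod 2) (ZMod 2) := by
    refine LinearMap.finrank_le_finrank_of_injective
      (f := ((LinearMap.proj f₀ : (F → ZMod 2) →ₗ[ZMod 2] ZMod 2).comp
        (LinearMap.fst _ _ _)).domRestrict _) ?_
    rw [injective_iff_map_eq_zero]
    rintro ⟨⟨g, ⟨f, hf⟩⟩, hg⟩ h0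
    have hgf : ∀ h, g (E.state h) = f h.1 := by
      intro h
      have hq := congrFun (LinearMap.mem_ker.1 hg) (Quotient.mk _ h)
      have hc : (E.rot⁻¹ * G.opp).SameCycle
          (Quotient.mk (Equiv.Perm.SameCycle.setoid (E.rot⁻¹ * G.opp)) h).out h :=
        Quotient.mk_out (s := Equiv.Perm.SameCycle.setoid (E.rot⁻¹ * G.opp)) h
      have hs := E.eq_of_sameCycle E.state E.state_next hc
      have hv := E.eq_of_sameCycle (fun h => f h.1)
        (fun h => by simp only [E.rot_inv_fst]; exact (hf h).symm) hc
      have hq' := CharTwo.add_eq_zero.1 hq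
      simp only at hq' hv
      rw [hs, hv] at hq'
      exact hq'
    have hg0 : g = 0 := by
      ext x
      rw [E.eq_of_forall_edge g (fun h => by rw [hgf, hgf, hf h]) x f₀]
      exact h0
    have hf0 : f = 0 := by
      ext v
      rw [← hgf (v, 0), hg0]
      rfl
    subst hg0 hf0
    rfl
  rw [Module.finrank_self] at h3
  omega

/-- On the sphere, every `ZMod 2`-cycle is the boundary of a set of states. -/
theorem range_coboundary : LinearMap.range E.coboundary = LinearMap.ker (vertexSum G) := by
  refine Submodule.eq_of_le_of_finrank_le E.range_coboundary_le ?_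
  have h1 := E.card_le_finrank_range_coboundary
  have h2 := finrank_ker_vertexSum_add_card G
  have h3 := E.card_add_finrank_le
  have h4 := E.euler
  -- With N circles and k components, #edges - #V + k = 2#F - N - 2 + k ≤ #F - 1, which bounds the
  -- cycle space by the rank of the coboundary.
  omega

theorem exists_coboundary (y : G.edges → Klein)
    (hy : ∀ v, y (G.edgeOf (v, 0)) + y (G.edgeOf (v, 1)) + y (G.edgeOf (v, 2)) = 0) :
    ∃ c : F → Klein, ∀ h, c (E.state h) + c (E.state (G.opp h)) = y (G.edgeOf h) := by
  have key : ∀ z : G.edges → ZMod 2,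
      (∀ v, z (G.edgeOf (v, 0)) + z (G.edgeOf (v, 1)) + z (G.edgeOf (v, 2)) = 0) →
      ∃ c : F → ZMod 2, ∀ h, c (E.state h) + c (E.state (G.opp h)) = z (G.edgeOf h) := by
    intro z hz
    have hz' : z ∈ LinearMap.ker (vertexSum G) := by
      ext v
      simpa [vertexSum, Fin.sum_univ_three] using hz v
    rw [← E.range_coboundary] at hz'
    obtain ⟨c, rfl⟩ := hz'
    exact ⟨c, fun h => rfl⟩
  obtain ⟨c₁, h₁⟩ := key (fun e => (y e).1) fun v => congrArg Prod.fst (hy v)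
  obtain ⟨c₂, h₂⟩ := key (fun e => (y e).2) fun v => congrArg Prod.snd (hy v)
  exact ⟨fun f => (c₁ f, c₂ f), fun h => Prod.ext (h₁ h) (h₂ h)⟩

end PlanarEmbedding

end OrientedTrivalentGraph

/-! ### Tait colorings and four-colorings -/

namespace OrientedTrivalentGraph

variable {V : Type*} [Fintype V] [DecidableEq V] {G : OrientedTrivalentGraph V}
  {F : Type*} [Fintype F]

namespace PlanarEmbedding

variable (E : G.PlanarEmbedding F)

/-- The sign comparing the rotation at a vertex with the given cyclic order. -/
def rotSign (v : V) : ℤ := if E.rot (v, 0) = (v, 1) then -1 else 1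

theorem leviCivita_edge_colors (x : G.edges → Fin 3) (c : F → Klein)
    (hc : ∀ h, kleinVec (x (G.edgeOf h)) = c (E.state h) + c (E.state (G.opp h))) (v : V) :
    leviCivita (x (G.edgeOf (v, 0))) (x (G.edgeOf (v, 1))) (x (G.edgeOf (v, 2))) =
      E.rotSign v * (tournament (c (E.state (v, 0))) (c (E.state (G.opp (v, 0)))) *
        tournament (c (E.state (v, 1))) (c (E.state (G.opp (v, 1)))) *
        tournament (c (E.state (v, 2))) (c (E.state (G.opp (v, 2))))) := by
  have e0 := hc (v, 0)
  have e1 := hc (v, 1)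
  have e2 := hc (v, 2)
  rcases E.rot_eq_or v with ⟨h0, h1, h2⟩ | ⟨h0, h1, h2⟩
  · rw [rotSign, if_pos h0]
    rw [E.state_opp_eq_of_rot_eq h2] at e0 ⊢
    rw [E.state_opp_eq_of_rot_eq h0] at e1 ⊢
    rw [E.state_opp_eq_of_rot_eq h1] at e2 ⊢
    rw [leviCivita_kleinVec _ _ _ _ _ _ e0 e1 e2]
    ring
  · rw [rotSign, if_neg (by rw [h2]; simp)]
    rw [E.state_opp_eq_of_rot_eq h0] at e0 ⊢
    rw [E.state_opp_eq_of_rot_eq h1] at e1 ⊢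
    rw [E.state_opp_eq_of_rot_eq h2] at e2 ⊢
    rw [leviCivita_kleinVec' _ _ _ _ _ _ e0 e1 e2]
    ring

theorem leviCivita_edge_colors_ne_zero (x : G.edges → Fin 3) (c : F → Klein)
    (hc : ∀ h, kleinVec (x (G.edgeOf h)) = c (E.state h) + c (E.state (G.opp h))) (v : V) :
    leviCivita (x (G.edgeOf (v, 0))) (x (G.edgeOf (v, 1))) (x (G.edgeOf (v, 2))) ≠ 0 := by
  rw [E.leviCivita_edge_colors x c hc]
  refine mul_ne_zero ?_ (mul_ne_zero (mul_ne_zero ?_ ?_) ?_)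
  · unfold rotSign
    split_ifs <;> simp
  all_goals exact tournament_ne_zero _ _

/-- The proper edge colorings of a trivalent graph with three colors. -/
def _root_.OrientedTrivalentGraph.TaitColoring (G : OrientedTrivalentGraph V) : Type _ :=
  {x : G.edges → Fin 3 // ∀ v,
    leviCivita (x (G.edgeOf (v, 0))) (x (G.edgeOf (v, 1))) (x (G.edgeOf (v, 2))) ≠ 0}

theorem exists_state_coloring (x : G.TaitColoring) : ∃ c : F → Klein,
    ∀ h, kleinVec (x.1 (G.edgeOf h)) = c (E.state h) + c (E.state (G.opp h)) := by
  obtain ⟨c, hc⟩ := E.exists_coboundary (fun e => kleinVec (x.1 e))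
    fun v => kleinVec_sum_eq_zero _ _ _ (x.2 v)
  exact ⟨c, fun h => (hc h).symm⟩

/-- All proper edge colorings contribute with the same sign. -/
theorem prod_leviCivita_taitColoring (x : G.TaitColoring) :
    ∏ v, leviCivita (x.1 (G.edgeOf (v, 0))) (x.1 (G.edgeOf (v, 1))) (x.1 (G.edgeOf (v, 2))) =
      (∏ v, E.rotSign v) * (-1) ^ G.edges.card := by
  obtain ⟨c, hc⟩ := E.exists_state_coloring x
  simp_rw [E.leviCivita_edge_colors x.1 c hc, Finset.prod_mul_distrib (f := E.rotSign)]
  rw [prod_vertices_halfEdges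
    (fun h => tournament (c (E.state h)) (c (E.state (G.opp h)))),
    G.prod_halfEdges _ (fun _ => -1)]
  · simp
  · intro h
    rw [G.opp_opp]
    refine tournament_mul_swap _ _ fun h0 => ?_
    apply kleinVec_ne_zero (x.1 (G.edgeOf h))
    rw [hc, h0]
    exact CharTwo.add_self_eq_zero _

theorem abs_sum_prod_leviCivita (E : G.PlanarEmbedding F) :
    |∑ x : G.edges → Fin 3, ∏ v : V, leviCivita (x (G.edgeOf (v, 0)))
      (x (G.edgeOf (v, 1))) (x (G.edgeOf (v, 2)))| = Nat.card G.TaitColoring := by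
  classical
  have hsplit : ∑ x : G.edges → Fin 3, ∏ v : V, leviCivita (x (G.edgeOf (v, 0)))
      (x (G.edgeOf (v, 1))) (x (G.edgeOf (v, 2))) =
      Nat.card G.TaitColoring * ((∏ v, E.rotSign v) * (-1) ^ G.edges.card) := by
    rw [← Finset.sum_filter_of_ne (p := fun x : G.edges → Fin 3 => ∀ v, leviCivita
      (x (G.edgeOf (v, 0))) (x (G.edgeOf (v, 1))) (x (G.edgeOf (v, 2))) ≠ 0)
      (fun x _ hx v => Finset.prod_ne_zero_iff.1 hx v (Finset.mem_univ v))]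
    rw [Finset.sum_congr rfl fun x hx =>
      E.prod_leviCivita_taitColoring ⟨x, (Finset.mem_filter.1 hx).2⟩]
    rw [Finset.sum_const, nsmul_eq_mul, TaitColoring, Nat.card_eq_fintype_card,
      Fintype.card_subtype]
  rw [hsplit, abs_mul, abs_mul, Finset.abs_prod]
  have hs : ∀ v, |E.rotSign v| = 1 := fun v => by
    unfold rotSign
    split_ifs <;> simp
  simp [hs]

theorem card_fourColoring : Nat.card E.FourColoring = 4 * Nat.card G.TaitColoring := by
  classical
  let K : Type _ := {c : F → Klein // ∀ h, c (E.state h) ≠ c (E.state (G.opp h))}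
  have h1 : Nat.card E.FourColoring = Nat.card K := by
    have ε : Fin 4 ≃ Klein := Fintype.equivOfCardEq rfl
    refine Nat.card_congr ((Equiv.arrowCongr (Equiv.refl F) ε).subtypeEquiv fun c => ?_)
    simp [Equiv.arrowCongr]
  choose g hg using E.exists_state_coloring
  obtain ⟨f₀⟩ := E.connected.nonempty
  have hdiff : ∀ (x : G.TaitColoring) (a : Klein) (h : V × Fin 3),
      kleinVec (x.1 (G.edgeOf h)) = (g x (E.state h) + a) + (g x (E.state (G.opp h)) + a) := by
    intro x a h
    rw [hg, add_add_add_comm, CharTwo.add_self_eq_zero a, add_zero]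
  let Φ : Klein × G.TaitColoring → K := fun p =>
    ⟨fun f => g p.2 f + p.1, fun h h0 => kleinVec_ne_zero (p.2.1 (G.edgeOf h)) (by
      rw [hdiff p.2 p.1]
      refine (congrArg (· + _) h0).trans ?_
      exact CharTwo.add_self_eq_zero _)⟩
  have hΦ : Function.Bijective Φ := by
    constructor
    · rintro ⟨a, x⟩ ⟨a', x'⟩ hp
      have hp' : ∀ f, g x f + a = g x' f + a' := fun f => congrFun (congrArg Subtype.val hp) f
      have hx : x = x' := by
        apply Subtype.ext
        ext1 e
        obtain ⟨h, rfl⟩ := G.edgeOf_surjective e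
        apply kleinVec_injective
        rw [hdiff x a, hdiff x' a', hp', hp']
      subst hx
      rw [add_left_cancel (hp' f₀)]
    · rintro ⟨c, hc⟩
      have hex : ∀ e : G.edges, ∃ a, ∀ h, G.edgeOf h = e →
          kleinVec a = c (E.state h) + c (E.state (G.opp h)) := by
        intro e
        obtain ⟨h, rfl⟩ := G.edgeOf_surjective e
        obtain ⟨a, ha⟩ := exists_kleinVec_eq (c (E.state h) + c (E.state (G.opp h)))
          fun h0 => hc h (CharTwo.add_eq_zero.1 h0)
        refine ⟨a, fun h' hh' => ?_⟩
        rcases (G.edgeOf_eq_iff).1 hh' with rfl | rfl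
        · exact ha
        · rw [G.opp_opp, ha, add_comm]
      choose x hx using hex
      have hx' := fun h => hx (G.edgeOf h) h rfl
      let X : G.TaitColoring := ⟨x, E.leviCivita_edge_colors_ne_zero x c hx'⟩
      -- Two state colorings with the same coboundary differ by a constant, read off at `f₀`.
      refine ⟨(g X f₀ + c f₀, X), ?_⟩
      apply Subtype.ext
      ext1 f
      change g X f + (g X f₀ + c f₀) = c f
      have hconst := E.eq_of_forall_edge (fun f => g X f + c f) (fun h => by
        rw [← CharTwo.add_eq_zero, add_add_add_comm, ← hg X, ← hx']
        exact CharTwo.add_self_eq_zero _) f₀ f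
      rw [hconst, ← add_assoc, CharTwo.add_self_eq_zero, zero_add]
  rw [h1, ← Nat.card_eq_of_bijective Φ hΦ, Nat.card_prod]
  congr 1
  rw [Nat.card_eq_fintype_card]
  rfl

end PlanarEmbedding

end OrientedTrivalentGraph

theorem proposition1p4 {V : Type*} [Fintype V] [DecidableEq V] (G : OrientedTrivalentGraph V)
    {F : Type*} [Fintype F] (E : G.PlanarEmbedding F)
    {ι : Type*} [Fintype ι] [DecidableEq ι] (b : Module.Basis ι ℂ SL2) :
    ‖G.weight sl2Metric b‖ =
      (2 : ℝ) ^ ((Fintype.card V : ℝ) / 2 - 2) * Nat.card E.FourColoring := by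
  -- The factor 2⁻² cancels the four translations of each state coloring.
  rw [G.norm_weight_sl2, ← Int.cast_abs, E.abs_sum_prod_leviCivita, E.card_fourColoring,
    Real.rpow_sub (by norm_num), div_eq_mul_one_div, Real.sqrt_eq_rpow,
    ← Real.rpow_natCast, ← Real.rpow_mul (by norm_num)]
  push_cast
  rw [mul_comm (1 / 2 : ℝ)]
  norm_num
  ring_nf
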